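/- For an integer $n\ge 1$, construct a sequence of pairs of integers as follows. Begin with $\langle 1,y_1\rangle=\langle 1,n\rangle$. Given a pair $\langle i,y_i\rangle$ with $y_i>i$, the next pair is $\langle i+1,y_{i+1}\rangle$, where $y_{i+1}$ is the smallest integer with $(i+1)\,y_{i+1}>i\,(y_i+1)$; the sequence stops at the first pair $\langle i,y_i\rangle$ with $y_i\le i$ (this always happens). The first entry of the final pair is called the strange root of $n$ and is denoted $\mathsf{sr}(n)$. Then for every natural number $k$ the number of integers $n\ge 1$ with $\mathsf{sr}(n)<k$ is finite, and it is asymptotically equal to $k^2/\pi$: $$\lim_{k\to\infty}\frac{\bigl|\{n\ge 1:\mathsf{sr}(n)<k\}\bigr|}{k^2/\pi}=1 .$$ -/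

import Mathlib

/-- The second entry of the pair that follows `⟨i, y⟩`: the smallest integer `z` with
`(i + 1) * z > i * (y + 1)` (see `isLeast_nextEntry`). -/
def nextEntry (i y : ℕ) : ℕ := i * (y + 1) / (i + 1) + 1

theorem isLeast_nextEntry (i y : ℕ) :
    IsLeast {z : ℤ | (i : ℤ) * (y + 1) < (i + 1) * z} (nextEntry i y : ℤ) := by
  have key : (nextEntry i y : ℤ) = (i : ℤ) * (y + 1) / (i + 1) + 1 := by
    unfold nextEntry
    push_cast
    rfl
  have hpos : (0 : ℤ) < (i : ℤ) + 1 := by positivity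
  rw [key]
  constructor
  · have h := Int.lt_ediv_add_one_mul_self ((i : ℤ) * (y + 1)) hpos
    rw [Set.mem_ofPred_eq, mul_comm ((i : ℤ) + 1)]
    exact h
  · intro z hz
    rw [Set.mem_ofPred_eq, mul_comm ((i : ℤ) + 1)] at hz
    exact Int.add_one_le_iff.mpr (Int.ediv_lt_of_lt_mul hpos hz)

theorem nextEntry_le {i y : ℕ} (h : i < y) : nextEntry i y ≤ y := by
  have : i * (y + 1) / (i + 1) < y := by
    rw [Nat.div_lt_iff_lt_mul (Nat.succ_pos i)]
    nlinarith
  exact this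

/-- The final pair reached from `⟨i, y⟩` by replacing, as long as `y > i`, the current pair
`⟨i, y⟩` by `⟨i + 1, nextEntry i y⟩`. -/
def finalPair (i y : ℕ) : ℕ × ℕ :=
  if i < y then finalPair (i + 1) (nextEntry i y) else (i, y)
termination_by y - i
decreasing_by
  rename_i h
  have := nextEntry_le h
  omega

/-- The strange root of `n ≥ 1`: the first entry of the final pair of the sequence of pairs
that begins with `⟨1, n⟩`. -/
def strangeRoot (n : ℕ) : ℕ := (finalPair 1 n).1

open Filter Topology

/-! Run the recursion backwards. `sr(n) < m + 2` means `n ≤ maxStart m m + 1`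
(`setOf_strangeRoot_lt`), so only `maxStart m m ~ m²/π` is needed. While `q / r` has integer part `a
+ 1`, lowering `r` by one raises `q` by `a`, so `q + a * r` is invariant. Going from `q ≈ (a+1)r` to
`q' ≈ (a+2)r'` gives `r' ≈ r(2a+1)/(2a+2)`; hence `r ≈ stageRatio a * m` at stage `a`. There
`maxStart r q` is `(a+1)r²` up to about `r²`. Let `m → ∞`, then `a → ∞`: by Wallis, `(a+1) *
stageRatio a ^ 2 → 1/π`, and the relative error vanishes. -/

/-- The second entry of the pair with first entry `m + 1` in the sequence that begins with
`⟨1, n⟩` and is continued forever. -/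
def entry (n : ℕ) : ℕ → ℕ
  | 0 => n
  | m + 1 => nextEntry (m + 1) (entry n m)

/-- The largest `x` such that the sequence that begins with `⟨1, x + 1⟩` has second entry at most
`q + 1` in the pair with first entry `r + 1` (for `r ≤ q`, see `entry_le_iff`). -/
def maxStart : ℕ → ℕ → ℕ
  | 0, q => q
  | r + 1, q => maxStart r (q + q / (r + 1) - 1)

theorem nextEntry_le_iff (i y q : ℕ) (hi : 0 < i) :
    nextEntry i y ≤ q + 1 ↔ y ≤ q + q / i := by
  have h1 : q + q / i = (i + 1) * q / i := by
    rw [add_mul, one_mul, Nat.mul_add_div hi]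
  rw [h1, Nat.le_div_iff_mul_le hi, nextEntry, Nat.add_le_add_iff_right,
    ← Nat.lt_add_one_iff, Nat.div_lt_iff_lt_mul (Nat.succ_pos i)]
  constructor <;> intro h <;> nlinarith

theorem nextEntry_le_succ {i y : ℕ} (hi : 0 < i) (h : y ≤ i) : nextEntry i y ≤ i + 1 := by
  rw [nextEntry_le_iff i y i hi]
  exact h.trans (Nat.le_add_right _ _)

theorem le_add_div_sub_one {r q : ℕ} (h : r + 1 ≤ q) : q ≤ q + q / (r + 1) - 1 := by
  have : 0 < q / (r + 1) := Nat.div_pos h (Nat.succ_pos r)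
  omega

/-- Each backward step inverts a bound on `nextEntry`; `m ≤ q` keeps the quotient positive, so `- 1`
never truncates. -/
theorem entry_le_iff (n m : ℕ) : ∀ q, m ≤ q → (entry n m ≤ q + 1 ↔ n ≤ maxStart m q + 1) := by
  induction m with
  | zero => intro q _; rfl
  | succ m ih =>
    intro q hq
    have h := le_add_div_sub_one hq
    rw [entry, maxStart, ← ih _ (by omega), nextEntry_le_iff _ _ _ (Nat.succ_pos m)]
    have : q + q / (m + 1) - 1 + 1 = q + q / (m + 1) := by omega
    rw [this]

theorem le_finalPair_fst (i y : ℕ) : i ≤ (finalPair i y).1 := by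
  induction i, y using finalPair.induct with
  | case1 i y h ih => rw [finalPair, if_pos h]; omega
  | case2 i y h => rw [finalPair, if_neg h]

theorem finalPair_eq_of_lt_entry (n m : ℕ) (h : m + 1 < entry n m) :
    finalPair 1 n = finalPair (m + 2) (entry n (m + 1)) := by
  induction m with
  | zero =>
    rw [finalPair, if_pos (by simpa [entry] using h)]
    rfl
  | succ m ih =>
    have h' : m + 1 < entry n m := by
      by_contra hc
      exact absurd h (not_lt.mpr (nextEntry_le_succ (Nat.succ_pos m) (not_lt.mp hc)))
    rw [ih h', finalPair, if_pos h]
    rfl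

/-- Once `y ≤ i` holds it persists, so the sequence can be continued past its end. -/
theorem strangeRoot_le_iff_entry_le (n m : ℕ) : strangeRoot n ≤ m + 1 ↔ entry n m ≤ m + 1 := by
  unfold strangeRoot
  constructor
  · intro h
    by_contra hc
    rw [finalPair_eq_of_lt_entry n m (not_le.mp hc)] at h
    have := le_finalPair_fst (m + 2) (entry n (m + 1))
    omega
  · intro h
    induction m with
    | zero =>
      rw [finalPair, if_neg (by simpa [entry] using h)]
    | succ m ih =>
      rcases le_or_gt (entry n m) (m + 1) with h' | h'
      · exact (ih h').trans (Nat.le_succ _)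
      · rw [finalPair_eq_of_lt_entry n m h', finalPair, if_neg (not_lt.mpr h)]

theorem setOf_strangeRoot_lt (m : ℕ) :
    {n : ℕ | 1 ≤ n ∧ strangeRoot n < m + 2} = Set.Icc 1 (maxStart m m + 1) := by
  ext n
  have h : strangeRoot n < m + 2 ↔ n ≤ maxStart m m + 1 := by
    rw [← entry_le_iff n m m le_rfl, ← strangeRoot_le_iff_entry_le, Nat.lt_succ_iff]
  change 1 ≤ n ∧ strangeRoot n < m + 2 ↔ 1 ≤ n ∧ n ≤ maxStart m m + 1
  rw [h]

theorem maxStart_le (r : ℕ) : ∀ q, r ≤ q → maxStart r q ≤ (r + 1) * q := by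
  induction r with
  | zero => intro q _; simp [maxStart]
  | succ r ih =>
    intro q hq
    have h := le_add_div_sub_one hq
    refine (ih _ (by omega)).trans ?_
    have h1 := Nat.mul_div_le q (r + 1)
    calc (r + 1) * (q + q / (r + 1) - 1) ≤ (r + 1) * (q + q / (r + 1)) :=
          Nat.mul_le_mul_left _ (Nat.sub_le _ _)
      _ ≤ (r + 1 + 1) * q := by nlinarith

/-- The floor and the `- 1` cost less than `2(r+1)` in the step from `r + 1`; these losses sum to
`r(r+1)`. -/
theorem le_maxStart_add (r : ℕ) : ∀ q, r ≤ q → (r + 1) * q ≤ maxStart r q + r * (r + 1) := by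
  induction r with
  | zero => intro q _; simp [maxStart]
  | succ r ih =>
    intro q hq
    have h := le_add_div_sub_one hq
    have h1 := ih _ (show r ≤ q + q / (r + 1) - 1 by omega)
    have h2 := Nat.lt_mul_div_succ q (Nat.succ_pos r)
    rw [maxStart]
    obtain ⟨w, hw⟩ : ∃ w, w = q + q / (r + 1) - 1 := ⟨_, rfl⟩
    have hw' : w + 1 = q + q / (r + 1) := by omega
    rw [← hw] at h1 ⊢
    have h3 : (r + 1) * (w + 1) = (r + 1) * (q + q / (r + 1)) := by rw [hw']
    simp only [Nat.succ_eq_add_one] at h2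
    nlinarith

/-- While the quotient of `q` by `r` is `a + 1`, a backward step preserves `q + a * r`. -/
theorem exists_maxStart_eq_of_quotient (a C r : ℕ) : ∀ q, (a + 1) * r ≤ q →
    q ≤ (a + 2) * r + (C + 2 * (a + 1)) →
    ∃ r' q', maxStart r q = maxStart r' q' ∧ q' + a * r' = q + a * r ∧
      (a + 2) * r' ≤ q' ∧ q' ≤ (a + 2) * r' + (C + 2 * (a + 1)) := by
  induction r with
  | zero => intro q h1 h2; exact ⟨0, q, rfl, rfl, by simp, h2⟩
  | succ r ih =>
    intro q h1 h2
    rcases le_or_gt ((a + 2) * (r + 1)) q with h | h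
    · exact ⟨r + 1, q, rfl, rfl, h, h2⟩
    · have hd : q / (r + 1) = a + 1 := by
        apply Nat.div_eq_of_lt_le
        · exact h1
        · exact h
      -- As `q < (a+2)(r+1)`, the overshoot of `q + a` over `(a+2)r` is at most `2a+1`, within the
      -- slack.
      obtain ⟨r', q', e1, e2, e3, e4⟩ := ih (q + a) (by nlinarith) (by nlinarith)
      refine ⟨r', q', ?_, ?_, e3, e4⟩
      · rw [maxStart, hd, ← e1]
        rfl
      · rw [e2]; ring

/-! ### Stage ratios and the Wallis product -/

/-- The limit of `r / m`, where `r + 1` is the index at which the quotient reaches `a + 1`. -/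
noncomputable def stageRatio : ℕ → ℝ
  | 0 => 1
  | a + 1 => stageRatio a * ((2 * a + 1) / (2 * a + 2))

theorem stageRatio_pos (a : ℕ) : 0 < stageRatio a := by
  induction a with
  | zero => exact one_pos
  | succ a ih => rw [stageRatio]; positivity

theorem wallis_mul_stageRatio_sq (a : ℕ) :
    Real.Wallis.W a * ((2 * a + 1) * stageRatio a ^ 2) = 1 := by
  induction a with
  | zero => simp [stageRatio, Real.Wallis.W]
  | succ a ih =>
    rw [Real.Wallis.W_succ, stageRatio]
    refine Eq.trans ?_ ih
    push_cast
    field_simp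
    ring

theorem stageRatio_sq (a : ℕ) : stageRatio a ^ 2 = (Real.Wallis.W a)⁻¹ * (2 * (a : ℝ) + 1)⁻¹ := by
  have h := wallis_mul_stageRatio_sq a
  have hW := Real.Wallis.W_pos a
  field_simp
  linarith

theorem tendsto_stageRatio_sq : Tendsto (fun a => stageRatio a ^ 2) atTop (𝓝 0) := by
  have h1 := Real.Wallis.tendsto_W_nhds_pi_div_two.inv₀ (by positivity)
  have h2 : Tendsto (fun a : ℕ => (2 * (a : ℝ) + 1)⁻¹) atTop (𝓝 0) :=
    tendsto_inv_atTop_zero.comp (tendsto_atTop_add_const_right _ _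
      (tendsto_natCast_atTop_atTop.const_mul_atTop two_pos))
  simpa [stageRatio_sq] using h1.mul h2

theorem tendsto_succ_mul_stageRatio_sq :
    Tendsto (fun a : ℕ => ((a : ℝ) + 1) * stageRatio a ^ 2) atTop (𝓝 (1 / Real.pi)) := by
  have h1 := (Real.Wallis.tendsto_W_nhds_pi_div_two.inv₀ (by positivity)).mul_const (1 / 2 : ℝ)
  have h2 := h1.add (tendsto_stageRatio_sq.mul_const (1 / 2 : ℝ))
  have e : (Real.pi / 2)⁻¹ * (1 / 2) + 0 * (1 / 2) = 1 / Real.pi := by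
    have := Real.pi_pos
    field_simp
    ring
  rw [e] at h2
  refine h2.congr fun a => ?_
  have hW := Real.Wallis.W_pos a
  rw [stageRatio_sq]
  field_simp
  ring

/-! ### Error bounds at a fixed stage, uniform in `m` -/

theorem exists_stage (a : ℕ) : ∃ C : ℕ, ∀ m : ℕ, ∃ r q : ℕ, maxStart m m = maxStart r q ∧
    (a + 1) * r ≤ q ∧ q ≤ (a + 1) * r + C ∧ |(r : ℝ) - stageRatio a * m| ≤ C := by
  induction a with
  | zero => exact ⟨0, fun m => ⟨m, m, rfl, by simp, by simp, by simp [stageRatio]⟩⟩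
  | succ a ih =>
    obtain ⟨C, hC⟩ := ih
    refine ⟨2 * C + 2 * (a + 1), fun m => ?_⟩
    obtain ⟨r, q, e, h1, h2, h3⟩ := hC m
    obtain ⟨r', q', e', h4, h5, h6⟩ := exists_maxStart_eq_of_quotient a C r q h1 (by nlinarith)
    refine ⟨r', q', e.trans e', h5, by linarith, ?_⟩
    -- Both bounds compare the two ends of the invariant `q + a * r`.
    have lower : (2 * a + 1) * r ≤ (2 * a + 2) * r' + (C + 2 * (a + 1)) := by nlinarith
    have upper : (2 * a + 2) * r' ≤ (2 * a + 1) * r + C := by nlinarith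
    have lower' : (2 * a + 1) * (r : ℝ) ≤ (2 * a + 2) * r' + (C + 2 * (a + 1)) := by
      exact_mod_cast lower
    have upper' : (2 * a + 2) * (r' : ℝ) ≤ (2 * a + 1) * r + C := by exact_mod_cast upper
    have ha : (0 : ℝ) ≤ a := Nat.cast_nonneg a
    have hC0 : (0 : ℝ) ≤ C := Nat.cast_nonneg C
    have hs : (2 * (a : ℝ) + 2) * stageRatio (a + 1) = (2 * a + 1) * stageRatio a := by
      rw [stageRatio]
      field_simp
    have hs' : (2 * (a : ℝ) + 2) * (stageRatio (a + 1) * m) =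
        (2 * a + 1) * (stageRatio a * m) := by
      rw [← mul_assoc, hs, mul_assoc]
    rw [abs_le] at h3 ⊢
    have k1 := mul_le_mul_of_nonneg_left h3.1 (show 0 ≤ 2 * (a : ℝ) + 1 by positivity)
    have k2 := mul_le_mul_of_nonneg_left h3.2 (show 0 ≤ 2 * (a : ℝ) + 1 by positivity)
    have hp : 0 < 2 * (a : ℝ) + 2 := by positivity
    have haC : 0 ≤ (a : ℝ) * C := by positivity
    push_cast
    constructor
    · refine le_of_mul_le_mul_left ?_ hp
      nlinarith [mul_nonneg ha ha]
    · refine le_of_mul_le_mul_left ?_ hp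
      nlinarith [mul_nonneg ha ha]

theorem stageRatio_le_one (a : ℕ) : stageRatio a ≤ 1 := by
  induction a with
  | zero => exact le_rfl
  | succ a ih =>
    rw [stageRatio]
    refine mul_le_one₀ ih (by positivity) ?_
    rw [div_le_one (by positivity)]
    linarith

theorem abs_maxStart_sub_le {a C r q : ℕ} (h1 : (a + 1) * r ≤ q) (h2 : q ≤ (a + 1) * r + C) :
    |(maxStart r q : ℝ) - (a + 1) * r ^ 2| ≤ (r : ℝ) ^ 2 + (a + C + 1) * (r + 1) := by
  have hq : r ≤ q := by nlinarith
  have u : (maxStart r q : ℝ) ≤ (r + 1) * q := by exact_mod_cast maxStart_le r q hq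
  have l : ((r : ℝ) + 1) * q ≤ maxStart r q + r * (r + 1) := by
    exact_mod_cast le_maxStart_add r q hq
  have h1' : ((a : ℝ) + 1) * r ≤ q := by exact_mod_cast h1
  have h2' : (q : ℝ) ≤ (a + 1) * r + C := by exact_mod_cast h2
  have hr : (0 : ℝ) ≤ r := Nat.cast_nonneg r
  have ha : (0 : ℝ) ≤ a := Nat.cast_nonneg a
  have hC : (0 : ℝ) ≤ C := Nat.cast_nonneg C
  have k1 := mul_le_mul_of_nonneg_left h1' (show 0 ≤ (r : ℝ) + 1 by positivity)
  have k2 := mul_le_mul_of_nonneg_left h2' (show 0 ≤ (r : ℝ) + 1 by positivity)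
  rw [abs_le]
  constructor <;> nlinarith [mul_nonneg ha hr, mul_nonneg hC hr]

theorem exists_abs_maxStart_sub_le (a : ℕ) : ∃ D : ℝ, ∀ m : ℕ,
    |(maxStart m m : ℝ) - (a + 1) * stageRatio a ^ 2 * m ^ 2| ≤
      stageRatio a ^ 2 * m ^ 2 + D * (m + 1) := by
  obtain ⟨C, hC⟩ := exists_stage a
  refine ⟨(a + 2) * (2 * C + C ^ 2) + (a + C + 1) * (C + 1), fun m => ?_⟩
  obtain ⟨r, q, e, h1, h2, h3⟩ := hC m
  rw [e]
  have h := abs_maxStart_sub_le h1 h2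
  have hs0 := (stageRatio_pos a).le
  have hs1 := stageRatio_le_one a
  set s := stageRatio a
  have hm : (0 : ℝ) ≤ m := Nat.cast_nonneg m
  have hr : (0 : ℝ) ≤ r := Nat.cast_nonneg r
  have ha : (0 : ℝ) ≤ a := Nat.cast_nonneg a
  have hc : (0 : ℝ) ≤ C := Nat.cast_nonneg C
  have hsm : s * m ≤ m := mul_le_of_le_one_left hm hs1
  have hsm0 : 0 ≤ s * m := by positivity
  have hrm : (r : ℝ) ≤ m + C := by linarith [(abs_le.mp h3).2]
  have sq : |(r : ℝ) ^ 2 - (s * m) ^ 2| ≤ (2 * C + C ^ 2) * (m + 1) := by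
    have : (r : ℝ) ^ 2 - (s * m) ^ 2 = (r - s * m) * (r + s * m) := by ring
    rw [this, abs_mul, abs_of_nonneg (show 0 ≤ (r : ℝ) + s * m by positivity)]
    calc _ ≤ (C : ℝ) * (2 * m + C) := mul_le_mul h3 (by linarith) (by positivity) hc
      _ ≤ _ := by nlinarith [mul_nonneg hc hm, mul_nonneg (sq_nonneg (C : ℝ)) hm]
  have hlin : ((a : ℝ) + C + 1) * (r + 1) ≤ (a + C + 1) * (C + 1) * (m + 1) := by
    rw [mul_assoc]
    gcongr
    nlinarith
  have tri : |(maxStart r q : ℝ) - (a + 1) * s ^ 2 * m ^ 2| ≤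
      |(maxStart r q : ℝ) - (a + 1) * r ^ 2| + (a + 1) * |(r : ℝ) ^ 2 - (s * m) ^ 2| := by
    rw [← abs_of_nonneg (show 0 ≤ (a : ℝ) + 1 by positivity), ← abs_mul,
      abs_of_nonneg (show 0 ≤ (a : ℝ) + 1 by positivity)]
    refine le_trans (le_of_eq ?_) (abs_add_le _ _)
    congr 1
    ring
  have sq' := (abs_le.mp sq).2
  have sq'' := mul_le_mul_of_nonneg_left sq (show 0 ≤ (a : ℝ) + 1 by positivity)
  calc _ ≤ _ := tri
    _ ≤ (r ^ 2 + (a + C + 1) * (r + 1)) + (a + 1) * ((2 * C + C ^ 2) * (m + 1)) :=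
        add_le_add h sq''
    _ ≤ _ := by nlinarith

theorem tendsto_maxStart_div :
    Tendsto (fun m : ℕ => (maxStart m m : ℝ) / (m : ℝ) ^ 2) atTop (𝓝 (1 / Real.pi)) := by
  rw [Metric.tendsto_atTop']
  intro ε hε
  -- The stage is fixed before `m` grows, since `D` depends on `a`.
  obtain ⟨a, ha1, ha2⟩ := ((tendsto_stageRatio_sq.eventually_lt_const
    (show 0 < ε / 3 by positivity)).and
    (Metric.tendsto_nhds.mp tendsto_succ_mul_stageRatio_sq (ε / 3) (by positivity))).exists
  obtain ⟨D, hD⟩ := exists_abs_maxStart_sub_le a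
  have hlim : Tendsto (fun m : ℕ => D * ((m : ℝ)⁻¹ + (m : ℝ)⁻¹ ^ 2)) atTop (𝓝 0) := by
    have h : Tendsto (fun m : ℕ => (m : ℝ)⁻¹) atTop (𝓝 0) := tendsto_inv_atTop_nhds_zero_nat
    simpa using (h.add (h.pow 2)).const_mul D
  obtain ⟨M, hM⟩ := eventually_atTop.mp
    (hlim.eventually_lt_const (show 0 < ε / 3 by positivity))
  refine ⟨M, fun m hm => ?_⟩
  have hm0 : (0 : ℝ) < m := by exact_mod_cast (Nat.zero_le M).trans_lt hm
  have hMm := hM m hm.le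
  rw [Real.dist_eq] at ha2 ⊢
  have key : |(maxStart m m : ℝ) / (m : ℝ) ^ 2 - (a + 1) * stageRatio a ^ 2| ≤
      stageRatio a ^ 2 + D * ((m : ℝ)⁻¹ + (m : ℝ)⁻¹ ^ 2) := by
    have e1 : (maxStart m m : ℝ) / (m : ℝ) ^ 2 - (a + 1) * stageRatio a ^ 2 =
        ((maxStart m m : ℝ) - (a + 1) * stageRatio a ^ 2 * m ^ 2) / (m : ℝ) ^ 2 := by
      field_simp
    rw [e1, abs_div, abs_of_pos (show 0 < (m : ℝ) ^ 2 by positivity), div_le_iff₀ (by positivity)]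
    refine (hD m).trans (le_of_eq ?_)
    field_simp
  calc _ ≤ _ := abs_sub_le _ ((a + 1) * stageRatio a ^ 2) _
    _ < ε := by linarith

theorem tendsto_maxStart_succ_div :
    Tendsto (fun m : ℕ => ((maxStart m m : ℝ) + 1) / (((m : ℝ) + 2) ^ 2 / Real.pi)) atTop
      (𝓝 1) := by
  have h : Tendsto (fun m : ℕ => (m : ℝ)⁻¹) atTop (𝓝 0) := tendsto_inv_atTop_nhds_zero_nat
  have h1 := tendsto_maxStart_div.add (h.pow 2)
  have h2 := ((h.const_mul 2).const_add 1).pow 2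
  have h3 := (h1.mul_const Real.pi).div h2 (by norm_num)
  have e : (1 / Real.pi + 0 ^ 2) * Real.pi / (1 + 2 * 0) ^ 2 = 1 := by
    have := Real.pi_pos
    field_simp
    norm_num
  rw [e] at h3
  refine h3.congr' ?_
  filter_upwards [eventually_gt_atTop 0] with m hm
  have hm0 : (0 : ℝ) < m := by exact_mod_cast hm
  have := Real.pi_pos
  simp only [Pi.div_apply]
  field_simp

theorem proposition3p5 :
    (∀ k : ℕ, {n : ℕ | 1 ≤ n ∧ strangeRoot n < k}.Finite) ∧
      Asymptotics.IsEquivalent Filter.atTop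
        (fun k : ℕ => ({n : ℕ | 1 ≤ n ∧ strangeRoot n < k}.ncard : ℝ))
        (fun k : ℕ => (k : ℝ) ^ 2 / Real.pi) := by
  constructor
  · intro k
    refine (Set.finite_Icc 1 (maxStart k k + 1)).subset ?_
    rw [← setOf_strangeRoot_lt]
    exact fun n hn => ⟨hn.1, hn.2.trans (by omega)⟩
  · refine Asymptotics.isEquivalent_of_tendsto_one ?_
    rw [← tendsto_add_atTop_iff_nat 2]
    refine tendsto_maxStart_succ_div.congr fun m => ?_
    simp only [Pi.div_apply]
    rw [setOf_strangeRoot_lt]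
    simp [Set.ncard_eq_toFinset_card']
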